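/- Let $\mathbb{N}=\{0,1,2,\dots\}$. A \emph{streaming algorithm} consists of buffer sizes $\beta(-1)=1$ and $\beta(t)\in\mathbb{N}$ for $t\in\mathbb{N}$, update maps $u^{(t)}:\mathbb{R}^{\beta(t-1)}\times\mathbb{R}\to\mathbb{R}^{\beta(t)}$ and output maps $m^{(t)}:\mathbb{R}^{\beta(t)}\to\mathbb{R}$ for $t\in\mathbb{N}$. On a stream $z=(z_0,z_1,\dots)\in\mathbb{R}^{\mathbb{N}}$ its states are $s^{(-1)}=0\in\mathbb{R}$ and $s^{(t)}=u^{(t)}(s^{(t-1)},z_t)\in\mathbb{R}^{\beta(t)}$, and its output at time $t$ is $m^{(t)}(s^{(t)})$. It is required that for each $t\in\mathbb{N}$ the map $(z_0,\dots,z_t)\mapsto s^{(t)}$ is continuous; the output maps need not be continuous. For a sequence $a=(a_0,a_1,\dots)\in\mathbb{R}^{\mathbb{N}}$ let $T=T[a]$ be the lower-triangular Toeplitz matrix with $T_{i,j}=a_{i-j}$ for $i\ge j$ and $T_{i,j}=0$ for $i<j$ $(i,j\in\mathbb{N})$. For $t\in\mathbb{N}$ and $\tau\in\mathbb{N}\cup\{\infty\}$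 with $\tau\ge t$, let $\mathsf{space}_a(t;\tau)$ be the minimum $b\in\mathbb{N}$ for which there is a streaming algorithm with $\max_{0\le t'\le t}\beta(t')\le b$ that computes $T$ correctly up to time $\tau$, that is, $m^{(t')}(s^{(t')})=(Tz)_{t'}$ for every stream $z\in\mathbb{R}^{\mathbb{N}}$ and every $t'\in\mathbb{N}$ with $t'\le\tau$. For $I,J\in\mathbb{N}$ let $H^{(I,J)}$ be the $(I+1)\times(J+1)$ Hankel matrix with entries $H^{(I,J)}_{i,j}=a_{i+j}$, $0\le i\le I$, $0\le j\le J$. \textbf{Lemma (small buffer, small rank).} For every $a\in\mathbb{R}^{\mathbb{N}}$ and all $t,I\in\mathbb{N}$, $$\mathsf{space}_a(t;t+I)\;\ge\;\operatorname{rank}\bigl(H^{(I,t)}\bigr).$$ -/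

import Mathlib

namespace Streaming

/-- The buffer size just before time `t`, i.e. `β(t-1)`, with the convention `β(-1) = 1`;
here `β` lists the buffer sizes at the times `0, 1, 2, …`. -/
def sizeBefore (β : ℕ → ℕ) : ℕ → ℕ
  | 0 => 1
  | t + 1 => β t

/-- The data of a streaming algorithm: the buffer sizes `β(t)` for `t ≥ 0`, the update maps
`u⁽ᵗ⁾ : ℝ^β(t-1) × ℝ → ℝ^β(t)` and the output maps `m⁽ᵗ⁾ : ℝ^β(t) → ℝ`. -/
structure StreamingMaps where
  bufferSize : ℕ → ℕ
  update : ∀ t : ℕ, (Fin (sizeBefore bufferSize t) → ℝ) × ℝ → (Fin (bufferSize t) → ℝ)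
  output : ∀ t : ℕ, (Fin (bufferSize t) → ℝ) → ℝ

/-- The state just before the entry `z t` arrives. At `t = 0` it is `0 ∈ ℝ`. -/
def StreamingMaps.stateBefore (A : StreamingMaps) (z : ℕ → ℝ) :
    ∀ t : ℕ, Fin (sizeBefore A.bufferSize t) → ℝ
  | 0 => 0
  | t + 1 => A.update t (A.stateBefore z t, z t)

/-- The state at time `t`, after the entry `z t` was processed. -/
def StreamingMaps.state (A : StreamingMaps) (z : ℕ → ℝ) (t : ℕ) : Fin (A.bufferSize t) → ℝ :=
  A.update t (A.stateBefore z t, z t)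

/-- The stream that starts with `w 0, …, w t` and is zero afterwards. -/
def padZero {t : ℕ} (w : Fin (t + 1) → ℝ) : ℕ → ℝ :=
  fun n => if h : n < t + 1 then w ⟨n, h⟩ else 0

/-- A streaming algorithm: for each `t` the map `(z 0, …, z t) ↦ state at time t` is continuous
(the state at time `t` does not depend on later entries of the stream, so these may be padded
by zeros). The output maps need not be continuous. -/
structure StreamingAlgorithm extends StreamingMaps where
  continuous_state : ∀ t : ℕ,
    Continuous fun w : Fin (t + 1) → ℝ => toStreamingMaps.state (padZero w) t

/-- The algorithm computes `M` correctly up to time `τ` (possibly `τ = ∞`): on every stream `z`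
and at every time `t ≤ τ` the output is `(M z)_t = ∑_j M_{t,j} z_j`. The sum is finite for a
lower-triangular `M`. -/
def StreamingAlgorithm.ComputesUpTo (A : StreamingAlgorithm) (M : Matrix ℕ ℕ ℝ) (τ : ℕ∞) : Prop :=
  ∀ (z : ℕ → ℝ) (t : ℕ), (t : ℕ∞) ≤ τ →
    HasSum (fun j : ℕ => M t j * z j) (A.output t (A.state z t))

/-- `space_M(t; τ)`: the minimal `b` such that some streaming algorithm computes `M` correctly up to
time `τ` and has buffer sizes at most `b` at the times `0, …, t` (`⊤` if there is no such algorithm). -/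
noncomputable def space (M : Matrix ℕ ℕ ℝ) (t : ℕ) (τ : ℕ∞) : ℕ∞ :=
  ⨅ b ∈ {b : ℕ | ∃ A : StreamingAlgorithm, A.ComputesUpTo M τ ∧ ∀ t' ≤ t, A.bufferSize t' ≤ b},
    (b : ℕ∞)

/-- The lower-triangular Toeplitz matrix `T[a]`. -/
def toeplitz (a : ℕ → ℝ) : Matrix ℕ ℕ ℝ :=
  Matrix.of fun i j => if j ≤ i then a (i - j) else 0

/-- `space_a(t; τ)`. -/
noncomputable def spaceSeq (a : ℕ → ℝ) (t : ℕ) (τ : ℕ∞) : ℕ∞ :=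
  space (toeplitz a) t τ

/-- The infinite Hankel matrix `H[a]`. -/
def hankel (a : ℕ → ℝ) : Matrix ℕ ℕ ℝ :=
  Matrix.of fun i j => a (i + j)

/-- The corner `H^{(I,J)}` of `H[a]`, with rows `0, …, I` and columns `0, …, J`. -/
def hankelCorner (a : ℕ → ℝ) (I J : ℕ) : Matrix (Fin (I + 1)) (Fin (J + 1)) ℝ :=
  (hankel a).submatrix (fun i => (i : ℕ)) (fun j => (j : ℕ))

end Streaming

/-! Feed `t + 1` entries followed by zeros. The outputs at times `t, …, t + I` are the Hankel corner
applied to the reversed prefix, and they depend on the prefix only through the state at time `t`. So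
a linear map of the given rank factors through a continuous map into `ℝ^β(t)`. A linear section of
it makes that map injective on a space of dimension equal to the rank, and invariance of dimension
gives rank at most `β(t)`. Invariance of dimension is reduced to the absence of a `C¹` retraction of
the ball onto the sphere, which is proved by a volume computation. -/

open Metric MeasureTheory Set Module
open scoped NNReal ContDiff

section Topology

variable {E : Type*} [NormedAddCommGroup E] [InnerProductSpace ℝ E] [FiniteDimensional ℝ E]

/-! ### No-retraction theorem, by volume -/

/-- The determinant of `1 + A` is recovered from its values along `x ↦ 1 + x • A`. -/
theorem ContinuousLinearMap.det_one_add_eq_sum_lagrange (A : E →L[ℝ] E) (s : Finset ℝ)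
    (hs : finrank ℝ E < s.card) :
    (1 + A).det = ∑ x ∈ s, (1 + x • A).det * (Lagrange.basis s id x).eval 1 := by
  classical
  let b := finBasis ℝ E
  let M := LinearMap.toMatrix b b (A : E →ₗ[ℝ] E)
  let P : Polynomial ℝ := Matrix.det
    ((Polynomial.X : Polynomial ℝ) • M.map Polynomial.C + (1 : Matrix _ _ ℝ).map Polynomial.C)
  have hP : ∀ x : ℝ, P.eval x = (1 + x • A).det := by
    intro x
    have h1 : P.eval x = (1 + x • M).det := by
      rw [← Polynomial.coe_evalRingHom, RingHom.map_det]
      congr 1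
      ext i j
      by_cases hij : i = j <;> simp [hij, add_comm, mul_comm (M _ _) x]
    have h2 : (1 + x • M) = LinearMap.toMatrix b b ((1 + x • A : E →L[ℝ] E) : E →ₗ[ℝ] E) := by
      rw [ContinuousLinearMap.toLinearMap_add, ContinuousLinearMap.toLinearMap_smul, map_add, map_smul]
      congr 1
      exact (LinearMap.toMatrix_one b).symm
    rw [h1, h2, LinearMap.det_toMatrix]
  have hdeg : P.degree < s.card := by
    refine Polynomial.degree_le_natDegree.trans_lt ?_
    have := Polynomial.natDegree_det_X_add_C_le M 1
    rw [Fintype.card_fin] at this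
    exact_mod_cast this.trans_lt hs
  have h := congrArg (Polynomial.eval 1)
    (Lagrange.eq_interpolate (v := id) (injOn_id (s : Set ℝ)) hdeg)
  rw [Lagrange.interpolate_apply, Polynomial.eval_finsetSum, hP, one_smul] at h
  rw [h]
  refine Finset.sum_congr rfl fun x _ => ?_
  simp [hP]

/-- A small perturbation of the identity that fixes the unit sphere and maps the unit ball to
itself is onto the ball. -/
theorem image_ball_eq_of_lipschitzOnWith_sub_id {f : E → E} {c : ℝ≥0} (hc : c < 1)
    (hf : LipschitzOnWith c (f - id) (closedBall 0 1))
    (hmap : MapsTo f (ball 0 1) (ball 0 1)) (hsph : ∀ x, ‖x‖ = 1 → f x = x) :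
    f '' ball 0 1 = ball 0 1 := by
  have hcont : ContinuousOn f (closedBall 0 1) := by
    have := hf.continuousOn.add continuousOn_id
    simpa using this
  have hopen : IsOpen (f '' ball 0 1) := by
    have h : ApproximatesLinearOn f (ContinuousLinearEquiv.refl ℝ E : E →L[ℝ] E) (ball 0 1) c :=
      (show LipschitzOnWith c (f - ((ContinuousLinearEquiv.refl ℝ E : E →L[ℝ] E) : E → E)) _ from
        hf.mono ball_subset_closedBall).approximatesLinearOn
    rcases subsingleton_or_nontrivial E with hE | hE
    · exact isOpen_discrete _
    · refine h.open_image (ContinuousLinearEquiv.refl ℝ E).toNonlinearRightInverse isOpen_ball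
        (Or.inr ?_)
      simpa [ContinuousLinearEquiv.toNonlinearRightInverse] using hc
  have hclosed : IsClosed (f '' closedBall 0 1) :=
    ((isCompact_closedBall (0 : E) 1).image_of_continuousOn hcont).isClosed
  -- The image of the open ball is thus relatively clopen in the connected ball.
  have hinter : ball (0 : E) 1 ∩ f '' closedBall 0 1 ⊆ f '' ball 0 1 := by
    rintro _ ⟨hy, x, hx, rfl⟩
    refine ⟨x, ?_, rfl⟩
    rcases (mem_closedBall_zero_iff.1 hx).lt_or_eq with h | h
    · exact mem_ball_zero_iff.2 h
    · rwa [hsph x h] at hy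
  refine (mapsTo_iff_image_subset.1 hmap).antisymm ?_
  have hpre : IsPreconnected (ball (0 : E) 1) := (convex_ball _ _).isPreconnected
  refine hpre.subset_of_closure_inter_subset hopen
    ⟨f 0, hmap (mem_ball_self one_pos), mem_image_of_mem f (mem_ball_self one_pos)⟩ ?_
  rintro y ⟨hy, hyb⟩
  exact hinter ⟨hyb, closure_minimal (image_mono ball_subset_closedBall) hclosed hy⟩

/-- There is no `C¹` retraction of the closed unit ball onto the unit sphere. -/
theorem not_exists_contDiff_retraction_sphere {k : E → E} (hk : ContDiff ℝ 1 k)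
    (hnorm : ∀ x, ‖k x‖ = 1) (hsph : ∀ x, ‖x‖ = 1 → k x = x) : False := by
  borelize E
  have hkd : Differentiable ℝ k := hk.differentiable one_ne_zero
  let A : E → E →L[ℝ] E := fun x => fderiv ℝ k x - 1
  have hA : Continuous A := (hk.continuous_fderiv one_ne_zero).sub continuous_const
  obtain ⟨K, hK⟩ := ((isCompact_closedBall (0 : E) 1).image_of_continuousOn
    hA.continuousOn).isBounded.exists_norm_le
  have hKA : ∀ x ∈ closedBall (0 : E) 1, ‖A x‖ ≤ K := fun x hx => hK _ (mem_image_of_mem _ hx)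
  have hK0 : 0 ≤ K := (norm_nonneg _).trans (hKA 0 (mem_closedBall_self zero_le_one))
  have hw : LipschitzOnWith K.toNNReal (k - id) (closedBall 0 1) := by
    refine (convex_closedBall _ _).lipschitzOnWith_of_nnnorm_hasFDerivWithin_le (f' := A)
      (fun x _ => ((hkd x).hasFDerivAt.sub (hasFDerivAt_id x)).hasFDerivWithinAt) fun x hx => ?_
    rw [← NNReal.coe_le_coe, coe_nnnorm, Real.coe_toNNReal _ hK0]
    exact hKA x hx
  obtain ⟨η, hη, hdet⟩ : ∃ η > 0, ∀ B : E →L[ℝ] E, ‖B‖ < η → 0 < (1 + B).det := by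
    have hc : ContinuousAt (fun B : E →L[ℝ] E => (1 + B).det) 0 :=
      (ContinuousLinearMap.continuous_det.comp (continuous_const.add continuous_id)).continuousAt
    have h0 : ∀ᶠ B : E →L[ℝ] E in nhds 0, 0 < (1 + B).det := by
      refine hc.eventually (lt_mem_nhds ?_)
      simp [ContinuousLinearMap.det]
    obtain ⟨η, hη, h⟩ := Metric.eventually_nhds_iff_ball.1 h0
    exact ⟨η, hη, fun B hB => h B (mem_ball_zero_iff.2 hB)⟩
  -- For `0 < x < σ`, the map `y + x • (k y - y)` preserves the ball (`x < 1`), is injective (`x * K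
  -- < 1`) and has positive Jacobian (`x * K < η`).
  let σ := min 1 (min η 1 / (K + 1))
  have hσ : 0 < σ := by positivity
  obtain ⟨s, hsI, hscard⟩ := (Set.Ioo_infinite hσ).exists_subset_card_eq (finrank ℝ E + 1)
  have hvol : ∀ x ∈ s, ∫ y in ball (0 : E) 1, (1 + x • A y).det =
      volume.real (ball (0 : E) 1) := by
    intro x hxs
    obtain ⟨hx0, hxσ⟩ := hsI hxs
    have hx1 : x < 1 := hxσ.trans_le (min_le_left _ _)
    have hxK : x * (K + 1) < min η 1 := (lt_div_iff₀ (by positivity)).1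
      (hxσ.trans_le (min_le_right _ _))
    have hxK' : x * K < min η 1 := by nlinarith
    let f : E → E := fun y => y + x • (k y - y)
    have hf' : ∀ y, HasFDerivAt f (1 + x • A y) y := fun y =>
      (hasFDerivAt_id y).add (((hkd y).hasFDerivAt.sub (hasFDerivAt_id y)).const_smul x)
    have hlip : LipschitzOnWith (x * K).toNNReal (f - id) (closedBall 0 1) := by
      refine LipschitzOnWith.of_dist_le_mul fun y hy z hz => ?_
      have h := hw.dist_le_mul y hy z hz
      rw [Real.coe_toNNReal _ hK0] at h
      rw [Real.coe_toNNReal _ (by positivity)]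
      have e : ∀ y, (f - id : E → E) y = x • (k - id : E → E) y := fun y => by simp [f]
      rw [e, e, dist_smul₀, Real.norm_of_nonneg hx0.le, mul_assoc]
      gcongr
    have hc : (x * K).toNNReal < 1 := by
      rw [← NNReal.coe_lt_coe, Real.coe_toNNReal _ (by positivity)]
      exact hxK'.trans_le (min_le_right _ _)
    have hinj : InjOn f (ball 0 1) := by
      intro y hy z hz hyz
      have h := hlip.dist_le_mul y (ball_subset_closedBall hy) z (ball_subset_closedBall hz)
      rw [dist_eq_norm] at h
      have e : (f - id : E → E) y - (f - id : E → E) z = z - y := by simp [hyz]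
      rw [e, ← dist_eq_norm, dist_comm] at h
      have hc' : (((x * K).toNNReal : ℝ≥0) : ℝ) < 1 := by exact_mod_cast hc
      by_contra hne
      nlinarith [dist_pos.2 hne]
    have himg : f '' ball 0 1 = ball 0 1 := by
      refine image_ball_eq_of_lipschitzOnWith_sub_id hc hlip (fun y hy => ?_) fun y hy => ?_
      · rw [mem_ball_zero_iff] at hy ⊢
        have e : f y = (1 - x) • y + x • k y := by simp only [f]; module
        calc ‖f y‖ ≤ ‖(1 - x) • y‖ + ‖x • k y‖ := e ▸ norm_add_le _ _
          _ = (1 - x) * ‖y‖ + x := by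
            rw [norm_smul, norm_smul, hnorm, Real.norm_of_nonneg hx0.le,
              Real.norm_of_nonneg (by linarith), mul_one]
          _ < 1 := by nlinarith
      · simp [f, hsph y hy]
    have hch := integral_image_eq_integral_abs_det_fderiv_smul volume measurableSet_ball
      (fun y _ => (hf' y).hasFDerivWithinAt) hinj (fun _ => (1 : ℝ))
    rw [himg] at hch
    simp only [integral_const, smul_eq_mul, mul_one, MeasurableSet.univ, measureReal_restrict_apply,
      univ_inter] at hch
    rw [hch]
    refine setIntegral_congr_fun measurableSet_ball fun y hy => (abs_of_pos (hdet _ ?_)).symm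
    rw [norm_smul, Real.norm_of_nonneg hx0.le]
    calc x * ‖A y‖ ≤ x * K := by
          gcongr
          exact hKA y (ball_subset_closedBall hy)
      _ < η := hxK'.trans_le (min_le_left _ _)
  -- Since `‖k‖` is constant, the derivative takes values orthogonal to `k y`, so it is not onto.
  have hzero : ∀ y, (1 + A y).det = 0 := by
    intro y
    have e : 1 + A y = fderiv ℝ k y := by simp [A]
    have horth : ∀ v, inner ℝ (k y) (fderiv ℝ k y v) = 0 := by
      intro v
      have h1 : HasFDerivAt (fun z => ‖k z‖ ^ 2) _ y := (hkd y).hasFDerivAt.norm_sq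
      have h2 : HasFDerivAt (fun z => ‖k z‖ ^ 2) (0 : E →L[ℝ] ℝ) y := by
        simp only [hnorm]
        exact hasFDerivAt_const _ _
      have h3 := congrArg (fun L : E →L[ℝ] ℝ => L v) (h1.unique h2)
      simpa using h3
    rw [e]
    by_contra hne
    have hsurj : Function.Surjective (fderiv ℝ k y) :=
      (LinearMap.equivOfDetNeZero (fderiv ℝ k y : E →ₗ[ℝ] E) hne).surjective
    obtain ⟨v, hv⟩ := hsurj (k y)
    have := horth v
    rw [hv, real_inner_self_eq_norm_sq, hnorm] at this
    norm_num at this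
  have hsum : ∑ x ∈ s, (Lagrange.basis s id x).eval (1 : ℝ) = 1 := by
    rw [← Polynomial.eval_finsetSum, Lagrange.sum_basis (injOn_id _)
      (Finset.card_pos.1 (by omega)), Polynomial.eval_one]
  have hint : ∀ x ∈ s, Integrable (fun y => (1 + x • A y).det * (Lagrange.basis s id x).eval 1)
      (volume.restrict (ball (0 : E) 1)) := by
    intro x _
    have : Continuous fun y => (1 + x • A y).det * (Lagrange.basis s id x).eval 1 :=
      (ContinuousLinearMap.continuous_det.comp
        (continuous_const.add (hA.const_smul x))).mul continuous_const
    exact (this.continuousOn.integrableOn_compact (isCompact_closedBall (0 : E) 1)).mono_set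
      ball_subset_closedBall
  -- The integrated Jacobian is polynomial in `x` and equals the ball's volume at the nodes;
  -- extrapolated to `x = 1` it must still be that volume, but there it vanishes.
  have hfinal : (0 : ℝ) = volume.real (ball (0 : E) 1) := by
    calc (0 : ℝ) = ∫ y in ball (0 : E) 1, (1 + A y).det := by simp [hzero]
      _ = ∫ y in ball (0 : E) 1, ∑ x ∈ s, (1 + x • A y).det * (Lagrange.basis s id x).eval 1 := by
        congr 1
        ext y
        exact (A y).det_one_add_eq_sum_lagrange s (by omega)
      _ = ∑ x ∈ s, volume.real (ball (0 : E) 1) * (Lagrange.basis s id x).eval 1 := by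
        rw [integral_finsetSum _ hint]
        refine Finset.sum_congr rfl fun x hx => ?_
        rw [integral_mul_const, hvol x hx]
      _ = volume.real (ball (0 : E) 1) := by rw [← Finset.mul_sum, hsum, mul_one]
  exact (ENNReal.toReal_pos (measure_ball_pos volume (0 : E) one_pos).ne'
    measure_ball_lt_top.ne).ne hfinal

/-! ### Invariance of dimension -/

/-- A continuous map close to the identity on the closed unit ball vanishes somewhere there. -/
theorem exists_eq_zero_of_norm_sub_le {h : E → E} (hh : Continuous h)
    (hclose : ∀ x, ‖x‖ ≤ 1 → ‖h x - x‖ ≤ 1 / 4) : ∃ x, ‖x‖ ≤ 1 ∧ h x = 0 := by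
  by_contra! hne
  obtain ⟨δ, hδ, hδh⟩ : ∃ δ > 0, ∀ x, ‖x‖ ≤ 1 → δ ≤ ‖h x‖ := by
    obtain ⟨x, hx, hmin⟩ := (isCompact_closedBall (0 : E) 1).exists_isMinOn
      ⟨0, mem_closedBall_self zero_le_one⟩ hh.norm.continuousOn
    exact ⟨‖h x‖, norm_pos_iff.2 (hne x (mem_closedBall_zero_iff.1 hx)),
      fun y hy => hmin (mem_closedBall_zero_iff.2 hy)⟩
  -- The bound `δ` keeps `g` nonzero where the bump is `1`; the bound `1 / 4` gives `‖g x - x‖ < 1 /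
  -- 2 < ‖x‖` on the transition annulus.
  obtain ⟨g, hg, hgh, -⟩ := hh.exists_contDiff_approx 1 (ε := fun _ => min δ (1 / 4))
    continuous_const (fun _ => by positivity)
  have hgh' : ∀ x, ‖g x - h x‖ < min δ (1 / 4) := fun x => by
    rw [← dist_eq_norm]; exact hgh x
  let χ : ContDiffBump (0 : E) := ⟨1 / 2, 1, by norm_num, by norm_num⟩
  let q : E → E := fun x => x + χ x • (g x - x)
  have hq : ContDiff ℝ 1 q := contDiff_id.add (χ.contDiff.smul (hg.sub contDiff_id))
  have hq1 : ∀ x, 1 ≤ ‖x‖ → q x = x := fun x hx => by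
    simp [q, χ.zero_of_le_dist (x := x) (by simpa [χ] using hx)]
  have hq0 : ∀ x, q x ≠ 0 := by
    intro x hx
    rcases le_or_gt 1 ‖x‖ with h1 | h1
    · rw [hq1 x h1] at hx
      simp [hx] at h1
      linarith
    rcases le_or_gt ‖x‖ (1 / 2) with h2 | h2
    · have e : q x = g x := by
        simp [q, χ.one_of_mem_closedBall (x := x) (by simpa [χ] using h2)]
      have h3 := hgh' x
      rw [← e, hx, zero_sub, norm_neg] at h3
      exact absurd (hδh x h1.le) (not_le.2 (h3.trans_le (min_le_left _ _)))
    · have h3 : ‖g x - x‖ < 1 / 2 := by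
        calc ‖g x - x‖ ≤ ‖g x - h x‖ + ‖h x - x‖ := norm_sub_le_norm_sub_add_norm_sub _ _ _
          _ < 1 / 4 + 1 / 4 := add_lt_add_of_lt_of_le
            ((hgh' x).trans_le (min_le_right _ _)) (hclose x h1.le)
          _ = 1 / 2 := by norm_num
      have h4 : ‖x‖ = ‖χ x • (g x - x)‖ := by
        rw [← norm_neg x, neg_eq_of_add_eq_zero_right hx]
      rw [norm_smul, Real.norm_of_nonneg χ.nonneg] at h4
      nlinarith [χ.le_one (x := x), χ.nonneg (x := x), norm_nonneg (g x - x)]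
  have hn0 : ∀ x, ‖q x‖ ≠ 0 := fun x => norm_ne_zero_iff.2 (hq0 x)
  refine not_exists_contDiff_retraction_sphere (k := fun x => ‖q x‖⁻¹ • q x)
    (((hq.norm ℝ hq0).inv hn0).smul hq) (fun x => ?_) fun x hx => ?_
  · rw [norm_smul, norm_inv, norm_norm, inv_mul_cancel₀ (hn0 x)]
  · simp [hq1 x hx.ge, hx]

/-- A continuous injective map does not lower the dimension. -/
theorem finrank_le_of_continuous_injective {F : Type*} [NormedAddCommGroup F] [NormedSpace ℝ F]
    [FiniteDimensional ℝ F] {f : E → F} (hf : Continuous f) (hinj : Function.Injective f) :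
    finrank ℝ E ≤ finrank ℝ F := by
  by_contra! hlt
  have hcompact : CompactSpace (closedBall (0 : E) 1) :=
    isCompact_iff_compactSpace.1 (isCompact_closedBall _ _)
  have he : Topology.IsClosedEmbedding fun x : closedBall (0 : E) 1 => f x :=
    (hf.comp continuous_subtype_val).isClosedEmbedding (hinj.comp Subtype.val_injective)
  have : TietzeExtension E := RCLike.instTietzeExtensionTVS (𝕜 := ℝ)
  -- Tietze extends the inverse of `f` on the ball to all of `F`. A `C¹` approximation of it misses
  -- a small `c` by dimension, so `g ∘ f - c` is near the identity without a zero.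
  obtain ⟨G, hG⟩ := ContinuousMap.exists_extension' he ⟨Subtype.val, continuous_subtype_val⟩
  have hGf : ∀ x, ‖x‖ ≤ 1 → G (f x) = x := fun x hx =>
    congrFun hG ⟨x, mem_closedBall_zero_iff.2 hx⟩
  obtain ⟨g, hg, hgG, -⟩ := G.continuous.exists_contDiff_approx 1 (ε := fun _ => 1 / 8)
    continuous_const (fun _ => by norm_num)
  obtain ⟨c, hc, hcr⟩ := (hg.dense_compl_range_of_finrank_lt_finrank hlt).exists_dist_lt
    (0 : E) (show (0 : ℝ) < 1 / 8 by norm_num)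
  obtain ⟨x, -, hx⟩ := exists_eq_zero_of_norm_sub_le (h := fun x => g (f x) - c)
    ((hg.continuous.comp hf).sub continuous_const) fun x hx => by
      have h1 := hgG (f x)
      rw [hGf x hx, dist_eq_norm] at h1
      rw [dist_zero_left] at hcr
      calc ‖g (f x) - c - x‖ = ‖(g (f x) - x) - c‖ := by congr 1; abel
        _ ≤ ‖g (f x) - x‖ + ‖c‖ := norm_sub_le _ _
        _ ≤ 1 / 4 := by linarith
  exact hc ⟨f x, sub_eq_zero.1 hx⟩

/-- If a linear map factors through a continuous map, its rank is at most the dimension of the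
space in the middle. -/
theorem LinearMap.finrank_range_le_of_factors_continuous {V W F : Type*}
    [NormedAddCommGroup V] [NormedSpace ℝ V] [FiniteDimensional ℝ V] [AddCommGroup W] [Module ℝ W]
    [NormedAddCommGroup F] [NormedSpace ℝ F] [FiniteDimensional ℝ F]
    (L : V →ₗ[ℝ] W) {f : V → F} (hf : Continuous f) (hL : ∀ x y, f x = f y → L x = L y) :
    finrank ℝ L.range ≤ finrank ℝ F := by
  obtain ⟨S, hS⟩ := L.rangeRestrict.exists_rightInverse_of_surjective L.range_rangeRestrict
  let e : EuclideanSpace ℝ (Fin (finrank ℝ L.range)) ≃ₗ[ℝ] L.range :=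
    LinearEquiv.ofFinrankEq _ _ (by simp)
  let ι : EuclideanSpace ℝ (Fin (finrank ℝ L.range)) →ₗ[ℝ] V := S ∘ₗ e
  have h := finrank_le_of_continuous_injective (hf.comp ι.continuous_of_finiteDimensional) (by
    intro x y hxy
    have h1 := hL _ _ hxy
    have h2 : ∀ z, L (ι z) = e z := fun z =>
      congrArg Subtype.val (LinearMap.congr_fun hS (e z))
    rw [h2, h2] at h1
    exact e.injective (Subtype.ext h1))
  simpa using h

end Topology

/-! ### From streaming states to Hankel rank -/

namespace Streaming

/-- From equal states at time `t`, zero inputs lead to equal states at all later times. -/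
theorem StreamingMaps.state_padZero_congr (A : StreamingMaps) {t : ℕ}
    {w w' : Fin (t + 1) → ℝ} (h : A.state (padZero w) t = A.state (padZero w') t) (i : ℕ) :
    A.state (padZero w) (t + i) = A.state (padZero w') (t + i) := by
  induction i with
  | zero => exact h
  | succ i ih =>
    have hz : ∀ v : Fin (t + 1) → ℝ, padZero v (t + i + 1) = 0 := fun v => dif_neg (by omega)
    change A.update (t + i + 1) (A.state (padZero w) (t + i), padZero w (t + i + 1)) =
      A.update (t + i + 1) (A.state (padZero w') (t + i), padZero w' (t + i + 1))
    rw [ih, hz, hz]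

theorem hasSum_toeplitz_padZero (a : ℕ → ℝ) {t : ℕ} (i : ℕ) (w : Fin (t + 1) → ℝ) :
    HasSum (fun j => toeplitz a (t + i) j * padZero w j)
      (∑ j : Fin (t + 1), a (i + (t - j)) * w j) := by
  have h := hasSum_sum_of_ne_finset_zero (L := .unconditional ℕ) (f := fun j => toeplitz a (t + i) j * padZero w j)
    (s := Finset.range (t + 1)) fun j hj => by
      rw [Finset.mem_range] at hj
      simp [padZero, hj]
  rw [Finset.sum_range] at h
  convert h using 2 with j
  have hj := j.2
  simp only [toeplitz, Matrix.of_apply, padZero, j.2, dite_true]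
  rw [if_pos (by omega)]
  congr 2
  omega

/-- Entry `j` has age `i + (t - j)` at time `t + i`, so the prefix must be reversed to match Hankel
columns. -/
theorem hankelCorner_mulVec (a : ℕ → ℝ) (I t : ℕ) (w : Fin (t + 1) → ℝ) (i : Fin (I + 1)) :
    (hankelCorner a I t).mulVec (w ∘ Fin.rev) i =
      ∑ j : Fin (t + 1), a (i + (t - j)) * w j := by
  rw [Matrix.mulVec, dotProduct, ← Equiv.sum_comp Fin.revPerm]
  refine Finset.sum_congr rfl fun j _ => ?_
  simp [hankelCorner, hankel, Fin.val_rev]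

theorem StreamingAlgorithm.rank_hankelCorner_le (A : StreamingAlgorithm) {a : ℕ → ℝ} {t I : ℕ}
    (hA : A.ComputesUpTo (toeplitz a) ((t + I : ℕ) : ℕ∞)) :
    (hankelCorner a I t).rank ≤ A.bufferSize t := by
  have hrev : Continuous fun v : Fin (t + 1) → ℝ => v ∘ Fin.rev := by fun_prop
  have h := (hankelCorner a I t).mulVecLin.finrank_range_le_of_factors_continuous
    ((A.continuous_state t).comp hrev) fun v v' hvv => by
      ext i
      have key : ∀ u : Fin (t + 1) → ℝ, (hankelCorner a I t).mulVec u i =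
          A.output (t + i) (A.state (padZero (u ∘ Fin.rev)) (t + i)) := fun u => by
        have h1 := hA (padZero (u ∘ Fin.rev)) (t + i) (by
          exact_mod_cast Nat.add_le_add_left (Nat.lt_succ_iff.1 i.2) t)
        rw [← h1.unique (hasSum_toeplitz_padZero a i (u ∘ Fin.rev)) |>.symm,
          ← hankelCorner_mulVec]
        congr 1
        ext j
        simp
      rw [Matrix.mulVecLin_apply, Matrix.mulVecLin_apply, key, key,
        A.state_padZero_congr hvv]
  simpa [Matrix.rank] using h

end Streaming

theorem mainTheorem5 (a : ℕ → ℝ) (t I : ℕ) :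
    ((Streaming.hankelCorner a I t).rank : ℕ∞) ≤
      Streaming.spaceSeq a t ((t + I : ℕ) : ℕ∞) := by
  refine le_iInf₂ fun b hb => ?_
  obtain ⟨A, hA, hsize⟩ := hb
  -- Only the buffer at time `t` itself is needed.
  exact_mod_cast (A.rank_hankelCorner_le hA).trans (hsize t le_rfl)
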